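/- For a finite group $X$, call $X$ minimal non-abelian if $X$ is non-abelian and every proper subgroup of $X$ is abelian, and let $\kappa_1(X)$ denote the number of $X$-conjugacy classes of minimal non-abelian subgroups of $X$ (where $X$ itself is allowed as a subgroup; in particular $\kappa_1(X)=0$ if $X$ is abelian). Let $p$ be a prime and let $G$ be a finite $p$-group. If $\kappa_1(G)\leq p$, then $\kappa_1(M)\leq p$ for every maximal subgroup $M$ of $G$. -/

import Mathlib

open scoped Pointwise

/-- A group is minimal non-abelian if it is not abelian but all its proper subgroups are. -/
def IsMinimalNonabelian (G : Type*) [Group G] : Prop :=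
  ¬ IsMulCommutative G ∧ ∀ H : Subgroup G, H ≠ ⊤ → IsMulCommutative H

/-- The set of all minimal non-abelian subgroups of `G`. -/
def minimalNonabelianSubgroups (G : Type*) [Group G] : Set (Subgroup G) :=
  {H | IsMinimalNonabelian H}

/-- `κ₁(G)`: the number of `G`-conjugacy classes (orbits under conjugation) of minimal
non-abelian subgroups of `G`. -/
noncomputable def kappaOne (G : Type*) [Group G] : ℕ :=
  (MulAction.orbit (ConjAct G) '' minimalNonabelianSubgroups G).ncard

/-! Maximal subgroups are kernels of characters to `ZMod p`. Let `M = ker φ` be non-abelian. In a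
pencil spanned by independent `φ`, `ψ`, two abelian kernels force all to be abelian
(`isMulCommutative_ker_of_two`), so `ψ` can be chosen with all `p` kernels of `φ * ψ ^ t`
non-abelian. Each contains a minimal non-abelian subgroup outside `ker ψ`, and these are pairwise
non-conjugate. Hence `κ₁(G) ≤ p` leaves a single `G`-class inside `M`, which splits into at most `|G
: M| = p` classes under `M`. -/

theorem isMulCommutative_subgroup_iff {G : Type*} [Group G] {H : Subgroup G} :
    IsMulCommutative H ↔ ∀ x ∈ H, ∀ y ∈ H, x * y = y * x := by
  simp [isMulCommutative_iff, Subtype.ext_iff]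

theorem isMulCommutative_map_iff {G G' : Type*} [Group G] [Group G'] {f : G →* G'}
    (hf : Function.Injective f) {H : Subgroup G} :
    IsMulCommutative (H.map f) ↔ IsMulCommutative H := by
  simp only [isMulCommutative_subgroup_iff, Subgroup.mem_map, forall_exists_index, and_imp,
    forall_apply_eq_imp_iff₂, ← map_mul, hf.eq_iff]

theorem isMinimalNonabelian_subgroup_iff {G : Type*} [Group G] {H : Subgroup G} :
    IsMinimalNonabelian H ↔ ¬ IsMulCommutative H ∧ ∀ K : Subgroup G, K < H →
      IsMulCommutative K := by
  refine and_congr_right fun _ => ⟨fun h K hK => ?_, fun h K hK => ?_⟩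
  · have h1 := h (K.subgroupOf H) fun e => hK.not_ge (Subgroup.subgroupOf_eq_top.1 e)
    rw [← isMulCommutative_map_iff H.subtype_injective,
      Subgroup.map_subgroupOf_eq_of_le hK.le] at h1
    exact h1
  · rw [← isMulCommutative_map_iff H.subtype_injective]
    refine h _ (lt_of_le_of_ne (Subgroup.map_subtype_le K) fun e => hK ?_)
    rw [eq_top_iff]
    rintro ⟨x, hx⟩ -
    rw [← e] at hx
    obtain ⟨y, hy, rfl⟩ := hx
    exact hy

theorem IsMinimalNonabelian.map {G G' : Type*} [Group G] [Group G'] {f : G →* G'}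
    (hf : Function.Injective f) {H : Subgroup G} (hH : IsMinimalNonabelian H) :
    IsMinimalNonabelian (H.map f) := by
  rw [isMinimalNonabelian_subgroup_iff] at hH ⊢
  refine ⟨by rw [isMulCommutative_map_iff hf]; exact hH.1, fun K hK => ?_⟩
  have hle : K ≤ f.range := hK.le.trans (Subgroup.map_le_range f H)
  rw [← Subgroup.map_comap_eq_self hle] at hK ⊢
  rw [isMulCommutative_map_iff hf]
  exact hH.2 _ ((Subgroup.map_lt_map_iff_of_injective hf).1 hK)

section PrimeCharacters

variable {p : ℕ} [Fact p.Prime] {G : Type*} [Group G]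

theorem exists_pow_eq_of_ne_one {c : Multiplicative (ZMod p)} (hc : c ≠ 1)
    (a : Multiplicative (ZMod p)) : ∃ k : ℕ, c ^ k = a :=
  mem_powers_of_prime_card (p := p) (by simp) hc

theorem jointly_surjective_of_not_le {φ ψ : G →* Multiplicative (ZMod p)} (hφ : φ.ker ≠ ⊤)
    (h : ¬ φ.ker ≤ ψ.ker) (a b : Multiplicative (ZMod p)) : ∃ g, φ g = a ∧ ψ g = b := by
  obtain ⟨z, hz⟩ : ∃ z, φ z ≠ 1 := by
    by_contra! hc
    exact hφ (eq_top_iff.2 fun x _ => hc x)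
  obtain ⟨x, hx, hx'⟩ := SetLike.not_le_iff_exists.1 h
  rw [MonoidHom.mem_ker] at hx hx'
  obtain ⟨k, hk⟩ := exists_pow_eq_of_ne_one hz a
  obtain ⟨j, hj⟩ := exists_pow_eq_of_ne_one hx' (b * (ψ (z ^ k))⁻¹)
  exact ⟨x ^ j * z ^ k, by simp [hx, hk], by rw [map_mul, map_pow, hj]; simp⟩

/-- If two independent characters have abelian kernels `ker ψ` and `ker (φ ψ ^ s)`, then every
character in their span has an abelian kernel; in particular `ker φ` is abelian. -/
theorem isMulCommutative_ker_of_two {φ ψ : G →* Multiplicative (ZMod p)}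
    (h : ∀ a b, ∃ g, φ g = a ∧ ψ g = b) (s : ℕ) (h1 : IsMulCommutative ψ.ker)
    (h2 : IsMulCommutative (φ * ψ ^ s).ker) : IsMulCommutative φ.ker := by
  rw [isMulCommutative_subgroup_iff] at *
  simp only [MonoidHom.mem_ker, MonoidHom.mul_apply, MonoidHom.pow_apply] at *
  -- The two abelian kernels together generate `G`: `g = u * (u⁻¹ * g)` with one factor in each.
  -- Their intersection is therefore central, and `ker φ` is cyclic modulo it.
  have central : ∀ z g, φ z = 1 → ψ z = 1 → z * g = g * z := by
    intro z g hz hz'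
    obtain ⟨u, hu, hu'⟩ := h ((ψ g ^ s)⁻¹) (ψ g)
    have e1 := h2 z (by simp [hz, hz']) u (by simp [hu, hu'])
    have e2 := h1 z hz' (u⁻¹ * g) (by simp [hu'])
    calc z * g = z * u * (u⁻¹ * g) := by group
      _ = u * (z * (u⁻¹ * g)) := by rw [e1]; group
      _ = g * z := by rw [e2]; group
  intro x hx y hy
  by_cases hx' : ψ x = 1
  · exact central x y hx hx'
  obtain ⟨k, hk⟩ := exists_pow_eq_of_ne_one hx' (ψ y)
  have e := central ((x ^ k)⁻¹ * y) x (by simp [hx, hy]) (by simp [hk])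
  calc x * y = x ^ k * (x * ((x ^ k)⁻¹ * y)) := by
        rw [← mul_assoc, (Commute.pow_self x k).eq]; group
    _ = y * x := by rw [← e]; group

theorem IsPGroup.exists_ker_eq_of_isCoatom [Finite G] (hG : IsPGroup p G) {M : Subgroup G}
    (hM : IsCoatom M) : ∃ φ : G →* Multiplicative (ZMod p), φ.ker = M := by
  have := hG.isNilpotent
  have hn : M.Normal := Subgroup.NormalizerCondition.normal_of_coatom M
    (Group.normalizerCondition_of_isNilpotent) hM
  obtain ⟨m, hm⟩ := IsPGroup.iff_card.1 (hG.to_subgroup M)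
  obtain ⟨n, hn'⟩ := IsPGroup.iff_card.1 hG
  have hp : p.Prime := Fact.out
  have hmn : m < n := by
    have : Nat.card M < Nat.card G := lt_of_le_of_ne (Subgroup.card_le_card_group M)
      fun e => hM.1 (Subgroup.eq_top_of_card_eq M e)
    rw [hm, hn'] at this
    exact (Nat.pow_lt_pow_iff_right hp.one_lt).1 this
  obtain ⟨K, hK, hMK⟩ := Sylow.exists_subgroup_card_pow_succ
    (hn' ▸ pow_dvd_pow p hmn : p ^ (m + 1) ∣ Nat.card G) hm
  have hKtop : K = ⊤ := hM.2 K (lt_of_le_of_ne hMK (by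
    rintro rfl
    rw [hm] at hK
    exact absurd (Nat.pow_right_injective hp.two_le hK) (by simp)))
  have hcard : Nat.card (G ⧸ M) = p := by
    have h1 := M.card_eq_card_quotient_mul_card_subgroup
    rw [hm, ← Subgroup.card_top (G := G), ← hKtop, hK, pow_succ, mul_comm] at h1
    exact (Nat.eq_of_mul_eq_mul_right (pow_pos hp.pos m) h1).symm
  let e : G ⧸ M ≃* Multiplicative (ZMod p) := mulEquivOfPrimeCardEq hcard (by simp)
  refine ⟨e.toMonoidHom.comp (QuotientGroup.mk' M), ?_⟩
  ext x
  simp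

/-- As `G` is not cyclic, an element outside `M` generates a proper subgroup, which lies in a second
maximal subgroup. -/
theorem IsPGroup.exists_jointly_surjective [Finite G] (hG : IsPGroup p G)
    (hna : ¬ IsMulCommutative G) {M : Subgroup G} (hM : IsCoatom M) :
    ∃ φ ψ : G →* Multiplicative (ZMod p), φ.ker = M ∧ ∀ a b, ∃ g, φ g = a ∧ ψ g = b := by
  obtain ⟨φ, rfl⟩ := hG.exists_ker_eq_of_isCoatom hM
  obtain ⟨x, -, hx⟩ := SetLike.exists_of_lt hM.lt_top
  have hz : Subgroup.zpowers x ≠ ⊤ := fun e => hna <| isMulCommutative_iff.2 fun a b => by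
    obtain ⟨i, rfl⟩ := Subgroup.mem_zpowers_iff.1 (e ▸ Subgroup.mem_top a)
    obtain ⟨j, rfl⟩ := Subgroup.mem_zpowers_iff.1 (e ▸ Subgroup.mem_top b)
    exact (Commute.zpow_zpow_self x i j).eq
  obtain ⟨N, hN, hxN⟩ := (eq_top_or_exists_le_coatom (Subgroup.zpowers x)).resolve_left hz
  obtain ⟨ψ, rfl⟩ := hG.exists_ker_eq_of_isCoatom hN
  refine ⟨φ, ψ, rfl, jointly_surjective_of_not_le hM.1 fun hle => hx ?_⟩
  rw [← hM.le_iff_eq hN.1 |>.1 hle]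
  exact hxN (Subgroup.mem_zpowers x)

/-- The minimal non-abelian subgroups of a non-abelian finite `p`-group generate it. -/
theorem IsPGroup.exists_isMinimalNonabelian_not_le [Finite G] (hG : IsPGroup p G)
    (hna : ¬ IsMulCommutative G) {L : Subgroup G} (hL : L ≠ ⊤) :
    ∃ H : Subgroup G, IsMinimalNonabelian H ∧ ¬ H ≤ L := by
  have hne : ({H | ¬ IsMulCommutative H ∧ ¬ H ≤ L} : Set (Subgroup G)).Nonempty := by
    refine ⟨⊤, fun h => hna ?_, fun h => hL (top_le_iff.1 h)⟩
    exact isMulCommutative_iff.2 fun a b =>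
      isMulCommutative_subgroup_iff.1 h a trivial b trivial
  obtain ⟨H, hH⟩ := (Set.toFinite _).exists_minimal hne
  obtain ⟨⟨hHna, hHL⟩, hmin⟩ := hH
  refine ⟨H, ⟨hHna, ?_⟩, hHL⟩
  -- By minimality of `H`, every proper non-abelian subgroup of `H` lies in `L ∩ H`. A non-abelian
  -- maximal subgroup `N` of `H` then equals `L ∩ H`, so the other maximal subgroups are abelian;
  -- two of them in a pencil with `N` make `N` abelian.
  by_contra! hc
  have hle : ∀ K : Subgroup H, K ≠ ⊤ → ¬ IsMulCommutative K → K ≤ L.subgroupOf H := by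
    intro K hK hKna
    by_contra hKL
    refine hK (eq_top_iff.2 fun x _ => ?_)
    have h1 := hmin ⟨by rwa [isMulCommutative_map_iff H.subtype_injective], fun h => hKL
      (Subgroup.map_le_iff_le_comap.1 h)⟩ (Subgroup.map_subtype_le K) x.2
    obtain ⟨y, hy, e⟩ := h1
    rwa [← Subtype.ext e]
  obtain ⟨K, hK, hKna⟩ := hc
  obtain ⟨N, hN, hKN⟩ := (eq_top_or_exists_le_coatom K).resolve_left hK
  have hNna : ¬ IsMulCommutative N := fun h => hKna <| isMulCommutative_subgroup_iff.2
    fun x hx y hy => isMulCommutative_subgroup_iff.1 h x (hKN hx) y (hKN hy)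
  have hLtop : L.subgroupOf H ≠ ⊤ := fun h => hHL (Subgroup.subgroupOf_eq_top.1 h)
  obtain ⟨φ, ψ, rfl, hs⟩ := (hG.to_subgroup H).exists_jointly_surjective hHna hN
  have hφL : φ.ker = L.subgroupOf H := by
    rw [hN.le_iff_eq hLtop |>.1 (hle _ hN.1 hNna)]
  obtain ⟨c, hc⟩ := exists_ne (1 : Multiplicative (ZMod p))
  -- `u` and `v` show that `ker ψ` and `ker (φ * ψ)` are not contained in `ker φ`.
  obtain ⟨u, hu, hu'⟩ := hs c 1
  obtain ⟨v, hv, hv'⟩ := hs c c⁻¹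
  refine hNna (isMulCommutative_ker_of_two hs 1 ?_ ?_)
  · by_contra h
    obtain ⟨w, hw, hw'⟩ := hs 1 c
    have := hle ψ.ker (fun e => hc (hw' ▸ (e ▸ Subgroup.mem_top w : w ∈ ψ.ker))) h
    rw [← hφL] at this
    exact hc (hu ▸ this hu')
  · by_contra h
    have := hle _ (fun e => hc (by
      have : u ∈ (φ * ψ ^ 1).ker := e ▸ Subgroup.mem_top u
      simpa [MonoidHom.mem_ker, hu, hu'] using this)) h
    rw [← hφL] at this
    exact hc (hv ▸ this (by simp [MonoidHom.mem_ker, hv, hv']))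

theorem IsPGroup.exists_isMinimalNonabelian_le_not_le [Finite G] (hG : IsPGroup p G)
    {N L : Subgroup G} (hna : ¬ IsMulCommutative N) (hL : ¬ N ≤ L) :
    ∃ H : Subgroup G, IsMinimalNonabelian H ∧ H ≤ N ∧ ¬ H ≤ L := by
  obtain ⟨H, hH, hHL⟩ := (hG.to_subgroup N).exists_isMinimalNonabelian_not_le hna
    (fun h => hL (Subgroup.subgroupOf_eq_top.1 h) : L.subgroupOf N ≠ ⊤)
  exact ⟨H.map N.subtype, hH.map N.subtype_injective, Subgroup.map_subtype_le H, fun h =>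
    hHL (Subgroup.map_le_iff_le_comap.1 h)⟩

/-- At most one kernel in the pencil is abelian; if it is some `ker (φ * ψ ^ t)`, that character
replaces `ψ`. -/
theorem exists_jointly_surjective_forall_not_isMulCommutative
    {φ ψ : G →* Multiplicative (ZMod p)} (hs : ∀ a b, ∃ g, φ g = a ∧ ψ g = b)
    (hna : ¬ IsMulCommutative φ.ker) :
    ∃ χ : G →* Multiplicative (ZMod p), (∀ a b, ∃ g, φ g = a ∧ χ g = b) ∧
      ∀ t : ℕ, ¬ IsMulCommutative (φ * χ ^ t).ker := by
  by_cases h : ∀ t : ℕ, ¬ IsMulCommutative (φ * ψ ^ t).ker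
  · exact ⟨ψ, hs, h⟩
  push Not at h
  obtain ⟨t, ht⟩ := h
  have hs' : ∀ a b, ∃ g, φ g = a ∧ (φ * ψ ^ t) g = b := by
    obtain ⟨c, hc⟩ := exists_ne (1 : Multiplicative (ZMod p))
    obtain ⟨u, hu, -⟩ := hs c 1
    refine jointly_surjective_of_not_le
      (fun e => hc (hu ▸ (e ▸ Subgroup.mem_top u : u ∈ φ.ker))) fun hle => hna ?_
    exact isMulCommutative_subgroup_iff.2 fun x hx y hy =>
      isMulCommutative_subgroup_iff.1 ht x (hle hx) y (hle hy)
  exact ⟨_, hs', fun s h => hna (isMulCommutative_ker_of_two hs' s ht h)⟩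

theorem le_of_orbit_eq {H K N : Subgroup G} [hN : N.Normal]
    (h : MulAction.orbit (ConjAct G) H = MulAction.orbit (ConjAct G) K) (hK : K ≤ N) :
    H ≤ N := by
  obtain ⟨g, rfl⟩ : H ∈ MulAction.orbit (ConjAct G) K := h ▸ MulAction.mem_orbit_self H
  intro x hx
  obtain ⟨y, hy, rfl⟩ := (Subgroup.mem_smul_pointwise_iff_exists _ _ _).1 hx
  rw [ConjAct.smul_def]
  exact hN.conj_mem y (hK hy) _

/-- A non-abelian maximal subgroup of a finite `p`-group `G` with `κ₁(G) ≤ p` contains only one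
`G`-class of minimal non-abelian subgroups. -/
theorem IsPGroup.exists_forall_orbit_eq_of_kappaOne_le [Finite G] (hG : IsPGroup p G)
    (hκ : kappaOne G ≤ p) {M : Subgroup G} (hM : IsCoatom M) (hna : ¬ IsMulCommutative M) :
    ∃ H₀ : Subgroup G, ∀ H : Subgroup G, IsMinimalNonabelian H → H ≤ M →
      H ∈ MulAction.orbit (ConjAct G) H₀ := by
  have hGna : ¬ IsMulCommutative G := fun h => hna inferInstance
  obtain ⟨φ, ψ₀, rfl, hs₀⟩ := hG.exists_jointly_surjective hGna hM
  obtain ⟨ψ, hs, hψ⟩ := exists_jointly_surjective_forall_not_isMulCommutative hs₀ hna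
  have hex : ∀ t : ℕ, ∃ H : Subgroup G, IsMinimalNonabelian H ∧ H ≤ (φ * ψ ^ t).ker ∧
      ¬ H ≤ ψ.ker := by
    intro t
    refine hG.exists_isMinimalNonabelian_le_not_le (hψ t) fun hle => ?_
    obtain ⟨c, hc⟩ := exists_ne (1 : Multiplicative (ZMod p))
    obtain ⟨g, hg, hg'⟩ := hs (c ^ t)⁻¹ c
    exact hc (hg' ▸ hle (by simp [MonoidHom.mem_ker, hg, hg']))
  choose H hH hHle hHψ using hex
  -- Two different kernels of this family meet inside `ker ψ`.
  have hind : ∀ s t : Fin p, ∀ K : Subgroup G, ¬ K ≤ ψ.ker → K ≤ (φ * ψ ^ (s : ℕ)).ker →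
      K ≤ (φ * ψ ^ (t : ℕ)).ker → s = t := by
    intro s t K hK hKs hKt
    obtain ⟨x, hx, hx'⟩ := SetLike.not_le_iff_exists.1 hK
    have e : ψ x ^ (s : ℕ) = ψ x ^ (t : ℕ) := by
      have e1 : φ x * ψ x ^ (s : ℕ) = 1 := hKs hx
      have e2 : φ x * ψ x ^ (t : ℕ) = 1 := hKt hx
      exact mul_left_cancel (e1.trans e2.symm)
    have ho : orderOf (ψ x) = p := orderOf_eq_prime
      (by simpa using pow_card_eq_one' (x := ψ x)) hx'
    exact Fin.ext (pow_injOn_Iio_orderOf (by simp [ho]) (by simp [ho]) e)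
  let T : Fin p → Set (Subgroup G) := fun t => MulAction.orbit (ConjAct G) (H t)
  have hT : Function.Injective T := fun s t e => hind s t (H s) (hHψ s) (hHle s)
    (le_of_orbit_eq e (hHle t))
  -- The `p` distinct classes `T t` exhaust all classes because `κ₁(G) ≤ p`; only `t = 0` gives
  -- subgroups of `ker φ`.
  have hrange : Set.range T = MulAction.orbit (ConjAct G) '' minimalNonabelianSubgroups G := by
    refine Set.eq_of_subset_of_ncard_le ?_ ?_ (Set.toFinite _)
    · rintro _ ⟨t, rfl⟩
      exact ⟨H t, hH t, rfl⟩
    · rw [Set.ncard_range_of_injective hT, Nat.card_fin]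
      exact hκ
  refine ⟨H 0, fun K hK hKφ => ?_⟩
  obtain ⟨t, ht⟩ : MulAction.orbit (ConjAct G) K ∈ Set.range T := hrange ▸ ⟨K, hK, rfl⟩
  let z : Fin p := ⟨0, (Fact.out : p.Prime).pos⟩
  have hz : t = z := hind t z (H t) (hHψ t) (hHle t) (le_of_orbit_eq ht (by simpa [z] using hKφ))
  have : MulAction.orbit (ConjAct G) K = MulAction.orbit (ConjAct G) (H 0) := by
    rw [← ht, hz]
  exact this ▸ MulAction.mem_orbit_self K

end PrimeCharacters

theorem corollary3p4 {G : Type*} [Group G] [Finite G] (p : ℕ) (hp : p.Prime)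
    (hG : IsPGroup p G) (hκ : kappaOne G ≤ p) (M : Subgroup G) (hM : IsCoatom M) :
    kappaOne M ≤ p := by
  have : Fact p.Prime := ⟨hp⟩
  by_cases hna : IsMulCommutative M
  · have : minimalNonabelianSubgroups M = ∅ :=
      Set.eq_empty_of_forall_notMem fun H hH => hH.1 inferInstance
    simp [kappaOne, this]
  obtain ⟨H₀, hH₀⟩ := hG.exists_forall_orbit_eq_of_kappaOne_le hκ hM hna
  obtain ⟨φ, rfl⟩ := hG.exists_ker_eq_of_isCoatom hM
  let F : G → Set (Subgroup φ.ker) := fun g =>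
    MulAction.orbit (ConjAct φ.ker) ((ConjAct.toConjAct g • H₀).subgroupOf φ.ker)
  -- The `M`-class of a `G`-conjugate of `H₀` depends only on the coset of the conjugating element,
  -- so there are at most `p` of them.
  have hF : ∀ g g', φ g = φ g' → F g = F g' := by
    intro g g' h
    have hm : g * g'⁻¹ ∈ φ.ker := by simp [MonoidHom.mem_ker, h]
    refine MulAction.orbit_eq_iff.2 ⟨ConjAct.toConjAct ⟨g * g'⁻¹, hm⟩, ?_⟩
    ext x
    simp [Subgroup.mem_subgroupOf, Subgroup.mem_pointwise_smul_iff_inv_smul_mem,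
      ConjAct.smul_def, mul_assoc]
  let s : Multiplicative (ZMod p) → G := Function.invFun φ
  have hs : ∀ g, φ (s (φ g)) = φ g := fun g => Function.invFun_eq ⟨g, rfl⟩
  have hsub : MulAction.orbit (ConjAct φ.ker) '' minimalNonabelianSubgroups φ.ker ⊆
      Set.range (F ∘ s) := by
    rintro _ ⟨K, hK, rfl⟩
    obtain ⟨g, hg⟩ := hH₀ (K.map φ.ker.subtype) (hK.map φ.ker.subtype_injective)
      (Subgroup.map_subtype_le K)
    refine ⟨φ (ConjAct.ofConjAct g), (hF _ (ConjAct.ofConjAct g) (hs _)).trans ?_⟩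
    have hg' : ConjAct.toConjAct (ConjAct.ofConjAct g) • H₀ = K.map φ.ker.subtype := hg
    change MulAction.orbit _ _ = _
    rw [hg']
    congr 1
    exact Subgroup.comap_map_eq_self_of_injective φ.ker.subtype_injective K
  calc kappaOne φ.ker ≤ (Set.range (F ∘ s)).ncard := Set.ncard_le_ncard hsub (Set.toFinite _)
    _ ≤ Nat.card (Multiplicative (ZMod p)) := by
      rw [← Set.image_univ, ← Set.ncard_univ]
      exact Set.ncard_image_le
    _ = p := by simp
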